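/- For a finite group $G$, the ordered Davenport constant $\mathsf D_o(G)$ is the least $k$ such that for all $\ell\ge k$ and every ordered sequence $(g_1,\dots,g_\ell)$ over $G$ there are $r\ge 1$ and indices $i_1<\dots<i_r$ with $g_{i_1}g_{i_2}\cdots g_{i_r}=1$. The Loewy length $\mathsf L(G)$ is the nilpotency index of the Jacobson radical of the group algebra $\mathbb F_2[G]$. Write $[x,y]=x^{-1}y^{-1}xy$, and let $o(x)$ be the order of $x$. Consider the following finite $2$-groups. - $G_1=(\langle c\rangle\times\langle a\rangle)\rtimes\langle b\rangle$ with $[a,b]=c$, $[a,c]=[b,c]=1$, $o(a)=2^\alpha$, $o(b)=2^\beta$, $o(c)=2^\gamma$, where $\alpha\ge\beta\ge\gamma\ge1$. - $G_2=\langle a\rangle\rtimes\langle b\rangle$ with $[a,b]=a^{2^{\alpha-\gamma}}$, $o(a)=2^\alpha$, $o(b)=2^\beta$, $o([a,b])=2^\gamma$, where $\alpha\ge2\gamma$, $\beta\ge\gamma\ge1$, $\alpha+\beta>3$. - $G_3=(\langle c\rangle\times\langle a\rangle)\rtimes\langle b\rangle$ with $[a,b]=a^{2^{\alpha-\gamma}}c$,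 $[c,b]=a^{-2^{2(\alpha-\gamma)}}c^{-2^{\alpha-\gamma}}$, $o(a)=2^\alpha$, $o(b)=2^\beta$, $o(c)=2^\sigma$, $o([a,b])=2^\gamma$, where $\beta\ge\gamma>\sigma\ge1$, $\alpha+\sigma\ge2\gamma$. - $G_4=(\langle c\rangle\times\langle a\rangle)\langle b\rangle$, with $\langle c\rangle\times\langle a\rangle$ normal, $o(a)=o(b)=2^{\gamma+1}$, $o([a,b])=2^\gamma$, $o(c)=2^{\gamma-1}$, $[a,b]=a^2c$, $[c,b]=a^{-4}c^{-2}$, $a^{2^\gamma}=b^{2^\gamma}$, where $\gamma\ge1$. Then $\mathsf D_o(G)=\mathsf L(G)$ in each of the following cases, with the value indicated: 1. $G\cong G_1$ with $\gamma=1$: $\mathsf D_o(G)=\mathsf L(G)=2^\alpha+2^\beta+1$; 2. $G\cong G_2$ (all parameters): $\mathsf D_o(G)=\mathsf L(G)=2^\alpha+2^\beta-1$; 3. $G\cong G_3$ with $\sigma=1$: $\mathsf D_o(G)=\mathsf L(G)=2^\alpha+2^\beta+1$; 4. $G\cong G_4$ with $\gamma\in\{1,2\}$: $\mathsf D_o(G)=\mathsf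 L(G)=2^{\gamma+2}-3$. -/

import Mathlib

/-- The commutator `[x, y] = x⁻¹ y⁻¹ x y`. (Mathlib's `⁅x, y⁆` is `x y x⁻¹ y⁻¹`.) -/
def groupCommutator {G : Type*} [Group G] (x y : G) : G := x⁻¹ * y⁻¹ * x * y

/-- `1 ∈ Π(S)` for an ordered sequence `S` over `G`: some nonempty ordered subsequence of `S`
has product `1`, the factors being multiplied in the order in which they appear. -/
def HasProductOneSubsequence {G : Type*} [Group G] (S : List G) : Prop :=
  ∃ T : List G, T.Sublist S ∧ T ≠ [] ∧ T.prod = 1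

/-- The ordered Davenport constant: the least `k` such that every ordered sequence over `G` of
length at least `k` has a nonempty ordered subsequence with product `1`. -/
noncomputable def orderedDavenport (G : Type*) [Group G] : ℕ :=
  sInf {k : ℕ | ∀ S : List G, k ≤ S.length → HasProductOneSubsequence S}

/-- The Loewy length of the group algebra `𝔽_p[G]`: the nilpotency index of its Jacobson radical,
that is, the least `n` with `J ^ n = 0`. -/
noncomputable def loewyLength (p : ℕ) (G : Type*) [Group G] : ℕ :=
  sInf {n : ℕ | Ring.jacobson (MonoidAlgebra (ZMod p) G) ^ n = ⊥}

/-- `N` is the internal direct product `⟨c⟩ × ⟨a⟩` of two cyclic subgroups. -/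
structure IsDirectProductOf {G : Type*} [Group G] (N : Subgroup G) (c a : G) : Prop where
  commute : Commute c a
  disjoint : Disjoint (Subgroup.zpowers c) (Subgroup.zpowers a)
  eq_sup : N = Subgroup.zpowers c ⊔ Subgroup.zpowers a

/-- `G` is the internal semidirect product `N ⋊ ⟨b⟩`. -/
structure IsSemidirectWith {G : Type*} [Group G] (N : Subgroup G) (b : G) : Prop where
  normal : N.Normal
  isComplement : Subgroup.IsComplement' N (Subgroup.zpowers b)

/-- `G ≅ G₁ = (⟨c⟩ × ⟨a⟩) ⋊ ⟨b⟩` with parameters `α ≥ β ≥ γ ≥ 1`. -/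
def IsG1 (α β γ : ℕ) (G : Type*) [Group G] : Prop :=
  (β ≤ α ∧ γ ≤ β ∧ 1 ≤ γ) ∧
  ∃ (a b c : G) (N : Subgroup G),
    IsDirectProductOf N c a ∧ IsSemidirectWith N b ∧
    orderOf a = 2 ^ α ∧ orderOf b = 2 ^ β ∧ orderOf c = 2 ^ γ ∧
    groupCommutator a b = c ∧ groupCommutator a c = 1 ∧ groupCommutator b c = 1

/-- `G ≅ G₂ = ⟨a⟩ ⋊ ⟨b⟩` with parameters `α ≥ 2γ`, `β ≥ γ ≥ 1`, `α + β > 3`. -/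
def IsG2 (α β γ : ℕ) (G : Type*) [Group G] : Prop :=
  (2 * γ ≤ α ∧ γ ≤ β ∧ 1 ≤ γ ∧ 3 < α + β) ∧
  ∃ a b : G,
    IsSemidirectWith (Subgroup.zpowers a) b ∧
    orderOf a = 2 ^ α ∧ orderOf b = 2 ^ β ∧ orderOf (groupCommutator a b) = 2 ^ γ ∧
    groupCommutator a b = a ^ (2 ^ (α - γ))

/-- `G ≅ G₃ = (⟨c⟩ × ⟨a⟩) ⋊ ⟨b⟩` with parameters `β ≥ γ > σ ≥ 1`, `α + σ ≥ 2γ`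
(so that `α > γ`, and `α - γ` is a true difference). -/
def IsG3 (α β γ σ : ℕ) (G : Type*) [Group G] : Prop :=
  (γ ≤ β ∧ σ < γ ∧ 1 ≤ σ ∧ 2 * γ ≤ α + σ) ∧
  ∃ (a b c : G) (N : Subgroup G),
    IsDirectProductOf N c a ∧ IsSemidirectWith N b ∧
    orderOf a = 2 ^ α ∧ orderOf b = 2 ^ β ∧ orderOf c = 2 ^ σ ∧
    orderOf (groupCommutator a b) = 2 ^ γ ∧
    groupCommutator a b = a ^ (2 ^ (α - γ)) * c ∧
    groupCommutator c b = (a ^ (2 ^ (2 * (α - γ))))⁻¹ * (c ^ (2 ^ (α - γ)))⁻¹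

/-- `G ≅ G₄ = (⟨c⟩ × ⟨a⟩)⟨b⟩` with parameter `γ ≥ 1`; here `⟨c⟩ × ⟨a⟩` is normal, every element
of `G` is a product of an element of `⟨c⟩ × ⟨a⟩` and a power of `b`, and the product is not
semidirect, because `a ^ (2 ^ γ) = b ^ (2 ^ γ)`. -/
def IsG4 (γ : ℕ) (G : Type*) [Group G] : Prop :=
  1 ≤ γ ∧
  ∃ (a b c : G) (N : Subgroup G),
    IsDirectProductOf N c a ∧ N.Normal ∧ (∀ g : G, ∃ n ∈ N, ∃ k : ℤ, g = n * b ^ k) ∧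
    orderOf a = 2 ^ (γ + 1) ∧ orderOf b = 2 ^ (γ + 1) ∧ orderOf (groupCommutator a b) = 2 ^ γ ∧
    orderOf c = 2 ^ (γ - 1) ∧
    groupCommutator a b = a ^ 2 * c ∧ groupCommutator c b = (a ^ 4)⁻¹ * (c ^ 2)⁻¹ ∧
    a ^ (2 ^ γ) = b ^ (2 ^ γ)

/-! Both invariants are trapped between the same two numbers. Over `𝔽₂`, expanding `∏ (1 - g)` along
a sequence with no product-one subsequence leaves coefficient `1` at the identity, so the product is
nonzero. As each `1 - g` lies in the radical `J`, this gives `D_o ≤ L`. It remains to find `v` with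
`J ^ v = 0` and a product-one free sequence of length `v - 1` (`orderedDavenport_eq_loewyLength`).

For the upper bound, give `a - 1` and `b - 1` weight `1` and `c - 1` weight `2`, since `c` arises
from a commutator. The relations make conjugation by `b` trivial up to higher weight, so
multiplication by any `g - 1` raises the weight of ordered monomials (`jacobson_of_conjugation`).
Truncating at the orders of the generators bounds the weight of nonzero monomials
(`monomial_eq_zero`).

For the lower bound, powers of `a` followed by powers of `b` suffice when `c` is trivial. When `c`
has order `2`, two more terms are gained by interleaving `b * a * b⁻¹` and `b * c`
(`not_hasProductOneSubsequence_interleaved`). -/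

open Submodule in
/-- Expanding `∏ (1 - g)` over `S` leaves, besides `1`, only products of nonempty subsequences. -/
theorem prod_one_sub_single_sub_one_mem {G : Type*} [Group G] (S : List G) :
    (S.map fun g => (1 - MonoidAlgebra.of (ZMod 2) G g)).prod - 1 ∈
      span (ZMod 2) {x | ∃ T : List G, T.Sublist S ∧ T ≠ [] ∧
        x = MonoidAlgebra.of (ZMod 2) G T.prod} := by
  induction S with
  | nil => simp
  | cons g S ih =>
    set V := span (ZMod 2) {x | ∃ T : List G, T.Sublist (g :: S) ∧ T ≠ [] ∧
        x = MonoidAlgebra.of (ZMod 2) G T.prod} with hV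
    rw [List.map_cons, List.prod_cons]
    generalize (S.map fun g => (1 - MonoidAlgebra.of (ZMod 2) G g)).prod = x at ih ⊢
    have h1 : x - 1 ∈ V := by
      refine span_mono ?_ ih
      rintro _ ⟨T, hT, h0, rfl⟩
      exact ⟨T, hT.cons g, h0, rfl⟩
    have h2 : MonoidAlgebra.of (ZMod 2) G g * (x - 1) ∈ V := by
      have : ∀ y ∈ span (ZMod 2) {x | ∃ T : List G, T.Sublist S ∧ T ≠ [] ∧
          x = MonoidAlgebra.of (ZMod 2) G T.prod},
          MonoidAlgebra.of (ZMod 2) G g * y ∈ V := by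
        intro y hy
        induction hy using span_induction with
        | mem y hy =>
          obtain ⟨T, hT, -, rfl⟩ := hy
          refine subset_span ⟨g :: T, hT.cons_cons g, by simp, by rw [List.prod_cons, map_mul]⟩
        | zero => simp
        | add y z _ _ hy hz => rw [mul_add]; exact V.add_mem hy hz
        | smul r y _ hy => rw [mul_smul_comm]; exact V.smul_mem r hy
      exact this _ ih
    have h3 : MonoidAlgebra.of (ZMod 2) G g ∈ V :=
      subset_span ⟨[g], by simp, by simp, by simp⟩
    have := V.sub_mem (V.sub_mem h1 h2) h3
    convert this using 1
    noncomm_ring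

/-- Compare coefficients at the identity: without a product-one subsequence only the term `1` of the
expansion contributes there. -/
theorem hasProductOneSubsequence_of_prod_eq_zero {G : Type*} [Group G] (S : List G)
    (h : (S.map fun g => (1 - MonoidAlgebra.of (ZMod 2) G g)).prod = 0) :
    HasProductOneSubsequence S := by
  by_contra hS
  have h1 := prod_one_sub_single_sub_one_mem S
  have h2 : ∀ y ∈ Submodule.span (ZMod 2) {x | ∃ T : List G, T.Sublist S ∧ T ≠ [] ∧
        x = MonoidAlgebra.of (ZMod 2) G T.prod}, y.coeff 1 = 0 := by
    intro y hy
    induction hy using Submodule.span_induction with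
    | mem y hy =>
      obtain ⟨T, hT, h0, rfl⟩ := hy
      have : T.prod ≠ 1 := fun h => hS ⟨T, hT, h0, h⟩
      simp [MonoidAlgebra.of_apply, this]
    | zero => simp
    | add y z _ _ hy hz => simp [hy, hz]
    | smul r y _ hy => simp [hy]
  have h3 := h2 _ h1
  rw [h] at h3
  simp [MonoidAlgebra.one_def] at h3

theorem list_prod_mem_ideal_pow {R : Type*} [Ring R] (J : Ideal R) [J.IsTwoSided] (l : List R)
    (h : ∀ x ∈ l, x ∈ J) : l.prod ∈ J ^ l.length := by
  induction l with
  | nil => simp [Submodule.pow_zero]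
  | cons x l ih =>
    rw [List.prod_cons, List.length_cons, Ideal.IsTwoSided.pow_succ]
    exact Ideal.mul_mem_mul (h x (by simp)) (ih fun y hy => h y (by simp [hy]))

/-- The augmentation map of `𝔽₂[G]`. -/
noncomputable def augmentation (G : Type*) [Group G] : MonoidAlgebra (ZMod 2) G →ₐ[ZMod 2] ZMod 2 :=
  MonoidAlgebra.lift (ZMod 2) (ZMod 2) G 1

theorem jacobson_le_ker_augmentation (G : Type*) [Group G] :
    Ring.jacobson (MonoidAlgebra (ZMod 2) G) ≤ RingHom.ker (augmentation G) := by
  have : (RingHom.ker (augmentation G)).IsMaximal := by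
    refine RingHom.ker_isMaximal_of_surjective _ fun x => ⟨algebraMap _ _ x, ?_⟩
    rw [AlgHom.commutes]; rfl
  exact Ring.jacobson_le_of_isMaximal _

/-- Thus the augmentation ideal is spanned by the `g - 1`, and a filtration need only be tested on
these. -/
theorem sub_augmentation_mem_span {G : Type*} [Group G] (x : MonoidAlgebra (ZMod 2) G) :
    x - algebraMap _ _ (augmentation G x) ∈
      Submodule.span (ZMod 2) (Set.range fun g => MonoidAlgebra.of (ZMod 2) G g - 1) := by
  induction x using MonoidAlgebra.induction_on with
  | of g => exact Submodule.subset_span ⟨g, by simp [augmentation, MonoidAlgebra.one_def]⟩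
  | add x y hx hy =>
    rw [map_add, map_add, add_sub_add_comm]
    exact Submodule.add_mem _ hx hy
  | smul r x hx =>
    have := Submodule.smul_mem _ r hx
    convert this using 1
    rw [map_smul, smul_sub, smul_eq_mul, map_mul, Algebra.smul_def r (algebraMap _ _ _)]

/-- A decreasing filtration that starts at the whole algebra, is raised by one step under every
`g - 1` and vanishes at `v` bounds the Loewy length, and each `g - 1` lies in the radical. -/
theorem jacobson_of_filtration {G : Type*} [Group G]
    (W : ℕ → Submodule (ZMod 2) (MonoidAlgebra (ZMod 2) G)) (v : ℕ)
    (h1 : 1 ∈ W 0)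
    (hstep : ∀ g : G, ∀ n, ∀ x ∈ W n, (MonoidAlgebra.of (ZMod 2) G g - 1) * x ∈ W (n + 1))
    (hanti : ∀ n, W (n + 1) ≤ W n) (hv : W v = ⊥) :
    Ring.jacobson (MonoidAlgebra (ZMod 2) G) ^ v = ⊥ ∧
      ∀ g : G, 1 - MonoidAlgebra.of (ZMod 2) G g ∈ Ring.jacobson (MonoidAlgebra (ZMod 2) G) := by
  have hker : ∀ y ∈ RingHom.ker (augmentation G), ∀ n, ∀ x ∈ W n, y * x ∈ W (n + 1) := by
    intro y hy n x hx
    have h := sub_augmentation_mem_span y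
    rw [RingHom.mem_ker] at hy
    rw [hy, map_zero, sub_zero] at h
    clear hy
    induction h using Submodule.span_induction with
    | mem y h => obtain ⟨g, rfl⟩ := h; exact hstep g n x hx
    | zero => simp
    | add y z _ _ hy hz => rw [add_mul]; exact Submodule.add_mem _ hy hz
    | smul r y _ hy => rw [smul_mul_assoc]; exact Submodule.smul_mem _ r hy
  have hpow : ∀ n, ∀ x ∈ Ring.jacobson (MonoidAlgebra (ZMod 2) G) ^ n, x ∈ W n := by
    intro n
    induction n with
    | zero =>
      intro x _
      have h := hker (x - algebraMap _ _ (augmentation G x))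
        (by rw [RingHom.mem_ker, map_sub, AlgHom.commutes]; exact sub_self _) 0 1 h1
      have h2 := Submodule.smul_mem _ (augmentation G x) h1
      have h3 := Submodule.add_mem _ (hanti 0 h) h2
      rwa [mul_one, Algebra.smul_def, mul_one, sub_add_cancel] at h3
    | succ n ih =>
      intro x hx
      rw [Ideal.IsTwoSided.pow_succ] at hx
      refine Submodule.smul_induction_on hx ?_ fun x y hx hy => Submodule.add_mem _ hx hy
      exact fun y hy x hx => hker y (jacobson_le_ker_augmentation G hy) n x (ih x hx)
  refine ⟨?_, fun g => ?_⟩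
  · rw [eq_bot_iff]
    intro x hx
    have := hpow v x hx
    rwa [hv] at this
  · rw [← Ideal.jacobson_bot, Ideal.mem_jacobson_iff]
    intro y
    have hu : y * (1 - MonoidAlgebra.of (ZMod 2) G g) ∈ RingHom.ker (augmentation G) := by
      rw [RingHom.mem_ker]; simp [augmentation, MonoidAlgebra.one_def]
    -- Multiplication by `u` climbs the filtration, so `u` is nilpotent and the inverse of `u + 1`
    -- is the required quasi-inverse.
    set u := y * (1 - MonoidAlgebra.of (ZMod 2) G g)
    have hun : ∀ n, u ^ n ∈ W n := by
      intro n
      induction n with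
      | zero => simpa using h1
      | succ n ih => rw [pow_succ']; exact hker u hu n _ ih
    have hnil : IsNilpotent u := ⟨v, by simpa [hv] using hun v⟩
    obtain ⟨z, hz⟩ := hnil.isUnit_add_one
    refine ⟨(z⁻¹ : _ˣ), ?_⟩
    rw [mul_assoc]
    change ((z⁻¹ : _ˣ) : MonoidAlgebra (ZMod 2) G) * u + _ - 1 ∈ _
    rw [← mul_add_one, ← hz, Units.inv_mul, sub_self]
    exact zero_mem _

/-- Sandwich principle: a bound `J ^ v = 0` and a product-one free sequence of length `v - 1`
determine both invariants. -/
theorem orderedDavenport_eq_loewyLength {G : Type*} [Group G] {v : ℕ}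
    (hv : Ring.jacobson (MonoidAlgebra (ZMod 2) G) ^ v = ⊥)
    (hJ : ∀ g : G, 1 - MonoidAlgebra.of (ZMod 2) G g ∈ Ring.jacobson (MonoidAlgebra (ZMod 2) G))
    (S : List G) (hS : S.length + 1 = v) (hfree : ¬ HasProductOneSubsequence S) :
    orderedDavenport G = loewyLength 2 G ∧ loewyLength 2 G = v := by
  have hL : loewyLength 2 G ≤ v := Nat.sInf_le hv
  have hL0 : Ring.jacobson (MonoidAlgebra (ZMod 2) G) ^ loewyLength 2 G = ⊥ :=
    Nat.sInf_mem (s := {n | Ring.jacobson (MonoidAlgebra (ZMod 2) G) ^ n = ⊥}) ⟨v, hv⟩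
  have hD : loewyLength 2 G ∈
      {k : ℕ | ∀ S : List G, k ≤ S.length → HasProductOneSubsequence S} := by
    intro S hS
    have h : HasProductOneSubsequence (S.take (loewyLength 2 G)) := by
      apply hasProductOneSubsequence_of_prod_eq_zero
      have := list_prod_mem_ideal_pow (Ring.jacobson (MonoidAlgebra (ZMod 2) G))
        ((S.take (loewyLength 2 G)).map fun g => (1 - MonoidAlgebra.of (ZMod 2) G g))
        (by
          intro x hx
          obtain ⟨g, -, rfl⟩ := List.mem_map.1 hx
          exact hJ g)
      rw [List.length_map, List.length_take_of_le hS, hL0] at this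
      exact this
    obtain ⟨T, hT, h⟩ := h
    exact ⟨T, hT.trans (List.take_sublist _ _), h⟩
  have hDL : orderedDavenport G ≤ loewyLength 2 G := Nat.sInf_le hD
  -- The set defining the infimum is nonempty by `hD`, so the infimum belongs to it and would apply
  -- to `S` if it were at most `v - 1`.
  have hDv : v ≤ orderedDavenport G := by
    by_contra h
    exact hfree (Nat.sInf_mem
      (s := {k : ℕ | ∀ S : List G, k ≤ S.length → HasProductOneSubsequence S}) ⟨_, hD⟩ S (by
        change orderedDavenport G ≤ _; omega))
  omega
open Submodule

/-! ### Weight filtrations in characteristic two -/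

section Filtration

variable {R : Type*} [Ring R] [Algebra (ZMod 2) R]

/-- Span of the monomials `A ^ i C ^ k` of weight at least `n`, where `C` has weight `2`. -/
def abelianFiltration (A C : R) (n : ℕ) : Submodule (ZMod 2) R :=
  span (ZMod 2) {x | ∃ i k, n ≤ i + 2 * k ∧ x = A ^ i * C ^ k}

/-- Span of the monomials `A ^ i C ^ k B ^ j` of weight at least `n`, where `C` has weight `2`. -/
def monomialFiltration (A B C : R) (n : ℕ) : Submodule (ZMod 2) R :=
  span (ZMod 2) {x | ∃ i k j, n ≤ i + 2 * k + j ∧ x = A ^ i * C ^ k * B ^ j}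

variable {A B C : R}

theorem abelianFiltration_anti {m n : ℕ} (h : m ≤ n) :
    abelianFiltration A C n ≤ abelianFiltration A C m := by
  refine span_mono ?_
  rintro _ ⟨i, k, h', rfl⟩
  exact ⟨i, k, h.trans h', rfl⟩

theorem monomialFiltration_anti {m n : ℕ} (h : m ≤ n) :
    monomialFiltration A B C n ≤ monomialFiltration A B C m := by
  refine span_mono ?_
  rintro _ ⟨i, k, j, h', rfl⟩
  exact ⟨i, k, j, h.trans h', rfl⟩

theorem mul_mem_abelianFiltration (hAC : Commute A C) {m n : ℕ} {x y : R}
    (hx : x ∈ abelianFiltration A C m) (hy : y ∈ abelianFiltration A C n) :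
    x * y ∈ abelianFiltration A C (m + n) := by
  have h : x * y ∈ abelianFiltration A C m * abelianFiltration A C n := mul_mem_mul hx hy
  rw [abelianFiltration, abelianFiltration, span_mul_span] at h
  refine span_mono ?_ h
  rintro _ ⟨_, ⟨i, k, h1, rfl⟩, _, ⟨i', k', h2, rfl⟩, rfl⟩
  refine ⟨i + i', k + k', by omega, ?_⟩
  change _ * _ = _
  rw [pow_add, pow_add, mul_assoc, ← mul_assoc (C ^ k), (hAC.pow_pow i' k).symm.eq]
  simp only [mul_assoc]

theorem pow_mul_pow_mem_abelianFiltration (i k : ℕ) :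
    A ^ i * C ^ k ∈ abelianFiltration A C (i + 2 * k) :=
  subset_span ⟨i, k, le_rfl, rfl⟩

theorem mul_pow_mem_monomialFiltration {m : ℕ} {x : R} (hx : x ∈ abelianFiltration A C m) (j : ℕ) :
    x * B ^ j ∈ monomialFiltration A B C (m + j) := by
  induction hx using span_induction with
  | mem x h =>
    obtain ⟨i, k, h, rfl⟩ := h
    exact subset_span ⟨i, k, j, by omega, rfl⟩
  | zero => simp
  | add y z _ _ hy hz => rw [add_mul]; exact Submodule.add_mem _ hy hz
  | smul r y _ hy => rw [smul_mul_assoc]; exact Submodule.smul_mem _ r hy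

/-- Elements `x` of weight `n` whose conjugate by `b` agrees with `x` up to weight `n + 1`. -/
def AlmostCommutes (A C b : R) (n : ℕ) (x : R) : Prop :=
  x ∈ abelianFiltration A C n ∧ ∃ y ∈ abelianFiltration A C (n + 1), b * x = (x + y) * b

theorem AlmostCommutes.mul (hAC : Commute A C) {b x x' : R} {m n : ℕ}
    (hx : AlmostCommutes A C b m x) (hx' : AlmostCommutes A C b n x') :
    AlmostCommutes A C b (m + n) (x * x') := by
  obtain ⟨h1, y, hy, h2⟩ := hx
  obtain ⟨h1', y', hy', h2'⟩ := hx'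
  refine ⟨mul_mem_abelianFiltration hAC h1 h1', x * y' + y * x' + y * y', ?_, ?_⟩
  · refine add_mem (add_mem ?_ ?_) ?_
    · rw [add_assoc]; exact mul_mem_abelianFiltration hAC h1 hy'
    · have := mul_mem_abelianFiltration hAC hy h1'
      rwa [show m + 1 + n = m + n + 1 by ring] at this
    · exact abelianFiltration_anti (by omega) (mul_mem_abelianFiltration hAC hy hy')
  · rw [← mul_assoc, h2, mul_assoc, h2']
    noncomm_ring

theorem AlmostCommutes.one (b : R) : AlmostCommutes A C b 0 1 :=
  ⟨by simpa using pow_mul_pow_mem_abelianFiltration (A := A) (C := C) 0 0, 0, zero_mem _, by simp⟩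

theorem AlmostCommutes.pow (hAC : Commute A C) {b x : R} {n : ℕ}
    (hx : AlmostCommutes A C b n x) (k : ℕ) : AlmostCommutes A C b (n * k) (x ^ k) := by
  induction k with
  | zero => simpa using AlmostCommutes.one b
  | succ k ih => rw [pow_succ, Nat.mul_succ]; exact ih.mul hAC hx

/-- Moving `b` to the right past `A ^ i * C ^ k` costs an error `y` of higher weight; writing `b =
(b - 1) + 1` on the right, the unchanged monomial cancels and every remaining term has gained
weight. -/
theorem mul_mem_monomialFiltration_of_almostCommutes {b : R} (hAC : Commute A C)
    (hA : AlmostCommutes A C b 1 A) (hC : AlmostCommutes A C b 2 C) {n : ℕ} {x : R}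
    (hx : x ∈ monomialFiltration A (b - 1) C n) :
    (b - 1) * x ∈ monomialFiltration A (b - 1) C (n + 1) := by
  induction hx using span_induction with
  | mem x h =>
    obtain ⟨i, k, j, h, rfl⟩ := h
    obtain ⟨h1, y, hy, h2⟩ := (hA.pow hAC i).mul hAC (hC.pow hAC k)
    rw [one_mul] at h1 hy
    have e : (b - 1) * (A ^ i * C ^ k * (b - 1) ^ j) =
        A ^ i * C ^ k * (b - 1) ^ (j + 1) + y * (b - 1) ^ j + y * (b - 1) ^ (j + 1) := by
      rw [← mul_assoc, sub_mul b, h2, pow_succ']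
      noncomm_ring
    rw [e]
    refine add_mem (add_mem ?_ ?_) ?_
    · exact monomialFiltration_anti (by omega) (mul_pow_mem_monomialFiltration h1 (j + 1))
    · exact monomialFiltration_anti (by omega) (mul_pow_mem_monomialFiltration hy j)
    · exact monomialFiltration_anti (by omega) (mul_pow_mem_monomialFiltration hy (j + 1))
  | zero => simp
  | add y z _ _ hy hz => rw [mul_add]; exact Submodule.add_mem _ hy hz
  | smul r y _ hy => rw [mul_smul_comm]; exact Submodule.smul_mem _ r hy

theorem left_mul_mem_monomialFiltration {n : ℕ} {x : R} (hx : x ∈ monomialFiltration A B C n) :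
    A * x ∈ monomialFiltration A B C (n + 1) := by
  induction hx using span_induction with
  | mem x h =>
    obtain ⟨i, k, j, h, rfl⟩ := h
    exact subset_span ⟨i + 1, k, j, by omega, by rw [pow_succ']; simp only [mul_assoc]⟩
  | zero => simp
  | add y z _ _ hy hz => rw [mul_add]; exact Submodule.add_mem _ hy hz
  | smul r y _ hy => rw [mul_smul_comm]; exact Submodule.smul_mem _ r hy

theorem central_mul_mem_monomialFiltration (hAC : Commute A C) {n : ℕ} {x : R}
    (hx : x ∈ monomialFiltration A B C n) : C * x ∈ monomialFiltration A B C (n + 1) := by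
  induction hx using span_induction with
  | mem x h =>
    obtain ⟨i, k, j, h, rfl⟩ := h
    refine subset_span ⟨i, k + 1, j, by omega, ?_⟩
    rw [pow_succ', ← mul_assoc, ← mul_assoc, ← mul_assoc, (hAC.pow_left i).symm.eq]
  | zero => simp
  | add y z _ _ hy hz => rw [mul_add]; exact Submodule.add_mem _ hy hz
  | smul r y _ hy => rw [mul_smul_comm]; exact Submodule.smul_mem _ r hy

/-- Frobenius for the commuting pair `x`, `1`; the ring itself need not be commutative. -/
theorem sub_one_pow_two_pow (x : R) (k : ℕ) : (x - 1) ^ 2 ^ k = x ^ 2 ^ k - 1 := by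
  have h2 : (1 : R) + 1 = 0 := by
    have : algebraMap (ZMod 2) R (1 + 1) = 0 := by
      rw [show (1 + 1 : ZMod 2) = 0 by decide, map_zero]
    simpa only [map_add, map_one] using this
  induction k with
  | zero => simp
  | succ k ih =>
    rw [show 2 ^ (k + 1) = 2 ^ k * 2 from pow_succ 2 k, pow_mul, pow_mul, ih]
    generalize x ^ 2 ^ k = y
    have e : (y - 1) ^ 2 = y ^ 2 - 1 - (1 + 1) * (y - 1) := by noncomm_ring
    rw [e, h2, zero_mul, sub_zero]

/-- Elements of weight `0` that are congruent to `1` up to weight `n`. -/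
def IsOneMod (A C : R) (n : ℕ) (x : R) : Prop :=
  x ∈ abelianFiltration A C 0 ∧ x - 1 ∈ abelianFiltration A C n

theorem IsOneMod.mul (hAC : Commute A C) {n : ℕ} {x y : R} (hx : IsOneMod A C n x)
    (hy : IsOneMod A C n y) : IsOneMod A C n (x * y) := by
  refine ⟨add_zero 0 ▸ mul_mem_abelianFiltration (m := 0) (n := 0) hAC hx.1 hy.1, ?_⟩
  have h := mul_mem_abelianFiltration hAC hx.1 hy.2
  rw [zero_add] at h
  convert add_mem h hx.2 using 1
  noncomm_ring

theorem IsOneMod.pow (hAC : Commute A C) {n : ℕ} {x : R} (hx : IsOneMod A C n x) (k : ℕ) :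
    IsOneMod A C n (x ^ k) := by
  induction k with
  | zero => exact ⟨by simpa using (AlmostCommutes.one (A := A) (C := C) 1).1, by simp⟩
  | succ k ih => rw [pow_succ]; exact ih.mul hAC hx

theorem isOneMod_of_sub_one_mem {n : ℕ} {x : R} (hx : x - 1 ∈ abelianFiltration A C n) :
    IsOneMod A C n x := by
  refine ⟨?_, hx⟩
  have := add_mem (abelianFiltration_anti (Nat.zero_le n) hx)
    (AlmostCommutes.one (A := A) (C := C) 1).1
  rwa [sub_add_cancel] at this

theorem isOneMod_pow_two_pow (a : R) (k : ℕ) : IsOneMod (a - 1) C (2 ^ k) (a ^ 2 ^ k) := by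
  apply isOneMod_of_sub_one_mem
  rw [← sub_one_pow_two_pow]
  simpa using pow_mul_pow_mem_abelianFiltration (A := a - 1) (C := C) (2 ^ k) 0

theorem isOneMod_right (c : R) : IsOneMod A (c - 1) 2 c := by
  apply isOneMod_of_sub_one_mem
  simpa using pow_mul_pow_mem_abelianFiltration (A := A) (C := c - 1) 0 1

theorem almostCommutes_left {a b c u : R} (hac : Commute (a - 1) (c - 1))
    (h : b * a = a * u * b) (hu : IsOneMod (a - 1) (c - 1) 2 u) :
    AlmostCommutes (a - 1) (c - 1) b 1 (a - 1) := by
  refine ⟨by simpa using pow_mul_pow_mem_abelianFiltration (A := a - 1) (C := c - 1) 1 0,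
    a * (u - 1), ?_, ?_⟩
  · have := mul_mem_abelianFiltration hac (isOneMod_pow_two_pow a 0).1 hu.2
    simpa using this
  · rw [mul_sub, h]; noncomm_ring

theorem almostCommutes_right {a b c w : R} (hac : Commute (a - 1) (c - 1))
    (h : b * c = c * w * b) (hw : IsOneMod (a - 1) (c - 1) 3 w) :
    AlmostCommutes (a - 1) (c - 1) b 2 (c - 1) := by
  refine ⟨by simpa using pow_mul_pow_mem_abelianFiltration (A := a - 1) (C := c - 1) 0 1,
    c * (w - 1), ?_, ?_⟩
  · have := mul_mem_abelianFiltration hac (isOneMod_right c).1 hw.2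
    simpa using this
  · rw [mul_sub, h]; noncomm_ring

end Filtration

open Submodule in
/-- If `b` acts on the abelian normal subgroup `⟨a, c⟩` by `b a b⁻¹ = a u`, `b c b⁻¹ = c w` with `u`
and `w` of large enough weight, then the Jacobson radical is governed by the monomials
`(a - 1) ^ i (c - 1) ^ k (b - 1) ^ j`. -/
theorem jacobson_of_conjugation {G : Type*} [Group G] [Finite G] {a b c : G} {v r s t : ℕ}
    (hgen : Subgroup.closure {a, b, c} = ⊤) (hac : Commute a c)
    (hba : b * a = a * (a ^ (2 * r) * c ^ s) * b) (hbc : b * c = c * a ^ (4 * t) * b)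
    (hv : ∀ i k j, v ≤ i + 2 * k + j →
      (MonoidAlgebra.of (ZMod 2) G a - 1) ^ i * (MonoidAlgebra.of (ZMod 2) G c - 1) ^ k *
        (MonoidAlgebra.of (ZMod 2) G b - 1) ^ j = 0) :
    Ring.jacobson (MonoidAlgebra (ZMod 2) G) ^ v = ⊥ ∧
      ∀ g : G, 1 - MonoidAlgebra.of (ZMod 2) G g ∈ Ring.jacobson (MonoidAlgebra (ZMod 2) G) := by
  set f := MonoidAlgebra.of (ZMod 2) G with hf
  have hAC : Commute (f a - 1) (f c - 1) :=
    (((hac.map f).sub_left (Commute.one_left _)).sub_right (Commute.one_right _))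
  have hu : IsOneMod (f a - 1) (f c - 1) 2 (f (a ^ (2 * r) * c ^ s)) := by
    rw [map_mul, map_pow, map_pow, pow_mul]
    exact ((isOneMod_pow_two_pow (f a) 1).pow hAC r).mul hAC ((isOneMod_right (f c)).pow hAC s)
  have hw : IsOneMod (f a - 1) (f c - 1) 3 (f (a ^ (4 * t))) := by
    rw [map_pow, pow_mul]
    have h := (isOneMod_pow_two_pow (C := f c - 1) (f a) 2).pow hAC t
    exact ⟨h.1, abelianFiltration_anti (by norm_num) h.2⟩
  have hA := almostCommutes_left (b := f b) hAC (by simp only [← map_mul, hba]) hu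
  have hC := almostCommutes_right (b := f b) hAC (by simp only [← map_mul, hbc]) hw
  refine jacobson_of_filtration (monomialFiltration (f a - 1) (f b - 1) (f c - 1)) v ?_ ?_ ?_ ?_
  · exact subset_span ⟨0, 0, 0, by simp, by simp⟩
  · intro g
    -- In a finite group inverses are positive powers, so only generators and products need
    -- checking.
    have hg : g ∈ Submonoid.closure {a, b, c} := by
      rw [← Subgroup.closure_toSubmonoid_of_finite, hgen]; trivial
    induction hg using Submonoid.closure_induction with
    | mem g hg =>
      intro n x hx
      rcases hg with rfl | rfl | rfl
      · exact left_mul_mem_monomialFiltration hx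
      · exact mul_mem_monomialFiltration_of_almostCommutes hAC hA hC hx
      · exact central_mul_mem_monomialFiltration hAC hx
    | one => intro n x hx; simp [hf, MonoidAlgebra.one_def]
    | mul g h _ _ ihg ihh =>
      intro n x hx
      have e : (f (g * h) - 1) * x =
          (f g - 1) * ((f h - 1) * x) + (f h - 1) * x + (f g - 1) * x := by
        rw [map_mul]; noncomm_ring
      rw [e]
      exact add_mem (add_mem (monomialFiltration_anti (by omega) (ihg _ _ (ihh n x hx)))
        (ihh n x hx)) (ihg n x hx)
  · exact fun n => monomialFiltration_anti (Nat.le_succ n)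
  · rw [eq_bot_iff, monomialFiltration, span_le]
    rintro _ ⟨i, k, j, h, rfl⟩
    exact hv i k j h

theorem of_sub_one_pow_two_pow {G : Type*} [Group G] (g : G) (k : ℕ) :
    (MonoidAlgebra.of (ZMod 2) G g - 1) ^ 2 ^ k = MonoidAlgebra.of (ZMod 2) G (g ^ 2 ^ k) - 1 := by
  rw [sub_one_pow_two_pow, map_pow]

/-- Vanishing of the monomials of large weight. The alternative `a ^ 2 ^ β = b ^ 2 ^ β` trades powers
of `b - 1` for powers of `a - 1`. -/
theorem monomial_eq_zero {G : Type*} [Group G] {a b c : G} {α β δ : ℕ}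
    (ha : a ^ 2 ^ α = 1) (hc : c ^ 2 ^ δ = 1) (hac : Commute a c)
    (hb : b ^ 2 ^ β = 1 ∨ b ^ 2 ^ β = a ^ 2 ^ β) (i k j : ℕ)
    (h : 2 ^ α + 2 ^ β + 2 * 2 ^ δ ≤ i + 2 * k + j + 3) :
    (MonoidAlgebra.of (ZMod 2) G a - 1) ^ i * (MonoidAlgebra.of (ZMod 2) G c - 1) ^ k *
        (MonoidAlgebra.of (ZMod 2) G b - 1) ^ j = 0 := by
  set f := MonoidAlgebra.of (ZMod 2) G with hf
  have hA : (f a - 1) ^ 2 ^ α = 0 := by rw [of_sub_one_pow_two_pow, ha, map_one, sub_self]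
  have hC : (f c - 1) ^ 2 ^ δ = 0 := by rw [of_sub_one_pow_two_pow, hc, map_one, sub_self]
  have hB : (f b - 1) ^ 2 ^ β = 0 ∨ (f b - 1) ^ 2 ^ β = (f a - 1) ^ 2 ^ β := by
    rw [of_sub_one_pow_two_pow, of_sub_one_pow_two_pow]
    rcases hb with hb | hb
    · left; rw [hb, map_one, sub_self]
    · right; rw [hb]
  have hAC : Commute (f a - 1) (f c - 1) :=
    (((hac.map f).sub_left (Commute.one_left _)).sub_right (Commute.one_right _))
  induction j using Nat.strong_induction_on generalizing i with
  | _ j ih =>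
    -- Trading `2 ^ β` factors `b - 1` for as many factors `a - 1` keeps the weight. Once `j < 2 ^
    -- β` and `i < 2 ^ α`, the weight bound forces `2 ^ δ ≤ k`.
    by_cases hj : 2 ^ β ≤ j
    · obtain ⟨j', rfl⟩ := Nat.exists_eq_add_of_le hj
      rcases hB with hB | hB
      · rw [pow_add, hB, zero_mul, mul_zero]
      · rw [pow_add, hB]
        have := ih j' (by have := Nat.two_pow_pos β; omega) (i + 2 ^ β) (by omega)
        rw [pow_add, mul_assoc (_ ^ i), (hAC.pow_pow _ _).eq] at this
        simpa only [mul_assoc] using this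
    · by_cases hi : 2 ^ α ≤ i
      · obtain ⟨i', rfl⟩ := Nat.exists_eq_add_of_le hi
        rw [pow_add, hA]; simp
      · have hk : 2 ^ δ ≤ k := by omega
        obtain ⟨k', rfl⟩ := Nat.exists_eq_add_of_le hk
        rw [pow_add (f c - 1), hC]; simp
-- Product-one free sequences
open Subgroup

theorem not_hasProductOneSubsequence_replicate {G : Type*} [Group G] {a b : G} {m K : ℕ}
    (ha : orderOf a = m) (hm : 0 < m) (hK : 0 < K)
    (hb : ∀ j, 0 < j → j < K → b ^ j ∉ zpowers a) :
    ¬ HasProductOneSubsequence (List.replicate (m - 1) a ++ List.replicate (K - 1) b) := by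
  rintro ⟨T, hT, hne, hprod⟩
  obtain ⟨T₁, T₂, rfl, h1, h2⟩ := List.sublist_append_iff.1 hT
  obtain ⟨i, hi, rfl⟩ := List.sublist_replicate_iff.1 h1
  obtain ⟨j, hj, rfl⟩ := List.sublist_replicate_iff.1 h2
  rw [List.prod_append, List.prod_replicate, List.prod_replicate] at hprod
  obtain rfl : j = 0 := by
    by_contra h
    refine hb j (by omega) (by omega) ?_
    rw [← inv_eq_of_mul_eq_one_right hprod]
    exact inv_mem (pow_mem (mem_zpowers a) i)
  obtain rfl : i = 0 := by
    by_contra h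
    rw [pow_zero, mul_one] at hprod
    exact pow_ne_one_of_lt_orderOf h (by omega) hprod
  simp at hne

/-- Modulo `N` a product-one subsequence uses none or all of the `K` terms involving `b`. With none,
`b * a * b⁻¹` or a nontrivial power of `a` is left over. With all, the leading conjugate merges with
the following `b`, and the relation `b * a ^ (e + i) * b ^ (K - 1) * c = 1` puts `b⁻¹ * c * b` in
`⟨a⟩`. -/
theorem not_hasProductOneSubsequence_interleaved {G : Type*} [Group G] {a b c : G} {m K : ℕ}
    (N : Subgroup G) [N.Normal] (haN : a ∈ N) (hcN : c ∈ N)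
    (ha : orderOf a = m) (hm : 0 < m) (hK : 2 ≤ K)
    (hb : ∀ j, 0 < j → j < K → b ^ j ∉ N) (hbK : b ^ K ∈ zpowers a)
    (hconj : b * a * b⁻¹ ∉ zpowers a) (hc : b⁻¹ * c * b ∉ zpowers a) :
    ¬ HasProductOneSubsequence (List.replicate 1 (b * a * b⁻¹) ++ (List.replicate 1 b ++
      (List.replicate (m - 1) a ++ (List.replicate (K - 2) b ++ List.replicate 1 (b * c))))) := by
  rintro ⟨T, hT, hne, hprod⟩
  obtain ⟨T₁, T, rfl, h1, hT⟩ := List.sublist_append_iff.1 hT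
  obtain ⟨T₂, T, rfl, h2, hT⟩ := List.sublist_append_iff.1 hT
  obtain ⟨T₃, T, rfl, h3, hT⟩ := List.sublist_append_iff.1 hT
  obtain ⟨T₄, T₅, rfl, h4, h5⟩ := List.sublist_append_iff.1 hT
  obtain ⟨e, he, rfl⟩ := List.sublist_replicate_iff.1 h1
  obtain ⟨f, hf, rfl⟩ := List.sublist_replicate_iff.1 h2
  obtain ⟨i, hi, rfl⟩ := List.sublist_replicate_iff.1 h3
  obtain ⟨j, hj, rfl⟩ := List.sublist_replicate_iff.1 h4
  obtain ⟨h, hh, rfl⟩ := List.sublist_replicate_iff.1 h5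
  simp only [List.prod_append, List.prod_replicate, conj_pow] at hprod
  have hmod : b ^ (f + (j + h)) ∈ N := by
    have hq := congrArg (QuotientGroup.mk' N) hprod
    have hqa : QuotientGroup.mk' N a = 1 := (QuotientGroup.eq_one_iff a).2 haN
    have hqc : QuotientGroup.mk' N c = 1 := (QuotientGroup.eq_one_iff c).2 hcN
    simp only [map_mul, map_pow, map_inv, hqa, hqc, one_pow, mul_one, one_mul, mul_inv_cancel,
      map_one, ← pow_add] at hq
    rw [← map_pow] at hq
    exact (QuotientGroup.eq_one_iff _).1 hq
  have hcount : f + (j + h) = 0 ∨ f + (j + h) = K := by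
    by_contra hcon
    exact hb _ (by omega) (by omega) hmod
  rcases hcount with h0 | hfull
  · obtain ⟨rfl, rfl, rfl⟩ : f = 0 ∧ j = 0 ∧ h = 0 := by omega
    simp only [pow_zero, mul_one, one_mul] at hprod
    interval_cases e
    · obtain rfl : i = 0 := by
        by_contra h
        simp only [pow_zero, mul_one, mul_inv_cancel, one_mul] at hprod
        exact pow_ne_one_of_lt_orderOf h (by omega) hprod
      simp at hne
    · apply hconj
      rw [pow_one] at hprod
      rw [eq_inv_of_mul_eq_one_left hprod]
      exact inv_mem (pow_mem (mem_zpowers a) i)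
  · obtain ⟨rfl, rfl, rfl⟩ : f = 1 ∧ j = K - 2 ∧ h = 1 := by omega
    apply hc
    have hpow : b * b ^ (K - 2) * b = b ^ K := by
      rw [← pow_succ', ← pow_succ]; congr 1; omega
    have hkey : a ^ e * a ^ i * (b⁻¹ * b ^ K) * c * b = 1 := by
      have h2 : b ^ (K - 2) * b = b⁻¹ * b ^ K := by rw [← hpow]; group
      have h3 : a ^ e * a ^ i * (b⁻¹ * b ^ K) * c * b =
          b⁻¹ * (b * a ^ e * b⁻¹ * (b ^ 1 * (a ^ i * (b ^ (K - 2) * (b * c) ^ 1)))) * b := by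
        rw [← h2]; simp only [pow_one]; group
      rw [h3, hprod]; group
    have hcomm : b⁻¹ * b ^ K = b ^ K * b⁻¹ := ((Commute.refl b).inv_left.pow_right K).eq
    rw [hcomm] at hkey
    have h4 : b⁻¹ * c * b = (a ^ e * a ^ i * b ^ K)⁻¹ := by
      apply eq_inv_of_mul_eq_one_right
      rw [← hkey]; group
    rw [h4]
    exact inv_mem (mul_mem (mul_mem (pow_mem (mem_zpowers a) e) (pow_mem (mem_zpowers a) i)) hbK)

/-- By finiteness, an element conjugating `⟨a⟩` into itself normalizes it, and then so does its
inverse. -/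
theorem conj_notMem_zpowers {G : Type*} [Group G] [Finite G] {a b : G}
    (h : b⁻¹ * a * b ∉ zpowers a) : b * a * b⁻¹ ∉ zpowers a := by
  intro hmem
  apply h
  have hnorm : b ∈ normalizer (zpowers a : Set G) := by
    apply mem_normalizer_fintype
    rintro _ ⟨k, rfl⟩
    change b * a ^ k * b⁻¹ ∈ zpowers a
    rw [← conj_zpow]
    exact zpow_mem hmem k
  exact (mem_normalizer_iff''.1 hnorm a).1 (mem_zpowers a)

/-- The generator `b⁻¹` is used because the commutator relations describe conjugation `x ↦ b⁻¹ * x *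
b`. -/
theorem closure_eq_top_of_mul_zpow {G : Type*} [Group G] {a b c : G}
    (h : ∀ g : G, ∃ n ∈ zpowers c ⊔ zpowers a, ∃ k : ℤ, g = n * b ^ k) :
    closure {a, b⁻¹, c} = ⊤ := by
  rw [eq_top_iff]
  rintro g -
  obtain ⟨n, hn, k, rfl⟩ := h g
  have ha : a ∈ closure {a, b⁻¹, c} := subset_closure (by simp)
  have hb : b⁻¹ ∈ closure {a, b⁻¹, c} := subset_closure (by simp)
  have hc : c ∈ closure {a, b⁻¹, c} := subset_closure (by simp)
  refine mul_mem ?_ (zpow_mem (inv_mem_iff.1 hb) k)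
  exact (sup_le (zpowers_le.2 hc) (zpowers_le.2 ha) : zpowers c ⊔ zpowers a ≤ _) hn

/-! ### The two values, for trivial `c` and for `c` of order two -/

/-- The invariants of a product `⟨a⟩⟨b⟩` with `b⁻¹ a b = a ^ (1 + 2 r)`. -/
theorem invariants_of_metacyclic {G : Type*} [Group G] [Finite G] {a b : G} {α β r : ℕ}
    (ha : orderOf a = 2 ^ α)
    (hb : ∀ j, 0 < j → j < 2 ^ β → b ^ j ∉ zpowers a)
    (hbK : b ^ 2 ^ β = 1 ∨ b ^ 2 ^ β = (a ^ 2 ^ β)⁻¹)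
    (hgen : ∀ g : G, ∃ n ∈ zpowers a, ∃ k : ℤ, g = n * b ^ k)
    (hba : b⁻¹ * a = a * a ^ (2 * r) * b⁻¹) :
    orderedDavenport G = loewyLength 2 G ∧ loewyLength 2 G = 2 ^ α + 2 ^ β - 1 := by
  have hα := Nat.two_pow_pos α
  have hβ := Nat.two_pow_pos β
  obtain ⟨h1, h2⟩ := jacobson_of_conjugation (a := a) (b := b⁻¹) (c := 1)
    (v := 2 ^ α + 2 ^ β - 1) (r := r) (s := 1) (t := 0)
    (closure_eq_top_of_mul_zpow (by simpa using hgen))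
    (Commute.one_right a) (by simpa using hba) (by simp) (by
      intro i k j h
      refine monomial_eq_zero (α := α) (β := β) (δ := 0) (by rw [← ha, pow_orderOf_eq_one])
        (by simp) (Commute.one_right a) ?_ i k j (by rw [pow_zero]; omega)
      rw [inv_pow, inv_eq_one, inv_eq_iff_eq_inv]
      exact hbK)
  refine orderedDavenport_eq_loewyLength h1 h2 _ ?_
    (not_hasProductOneSubsequence_replicate ha hα hβ hb)
  simp only [List.length_append, List.length_replicate]
  omega

/-- The invariants of a product `(⟨c⟩ × ⟨a⟩)⟨b⟩` with `c` of order `2`, `b⁻¹ a b = a ^ (1 + 2 r) c` and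
`b⁻¹ c b = c a ^ (4 t)`. -/
theorem invariants_of_rank_two_base {G : Type*} [Group G] [Finite G] {a b c : G} {α β r t : ℕ}
    {N : Subgroup G} (hβ1 : 1 ≤ β) (hN : IsDirectProductOf N c a) (hnormal : N.Normal)
    (hgen : ∀ g : G, ∃ n ∈ N, ∃ k : ℤ, g = n * b ^ k)
    (ha : orderOf a = 2 ^ α) (hc : orderOf c = 2)
    (hb : ∀ j, 0 < j → j < 2 ^ β → b ^ j ∉ N)
    (hbK : b ^ 2 ^ β = 1 ∨ b ^ 2 ^ β = (a ^ 2 ^ β)⁻¹)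
    (hba : b⁻¹ * a = a * (a ^ (2 * r) * c) * b⁻¹) (hbc : b⁻¹ * c = c * a ^ (4 * t) * b⁻¹) :
    orderedDavenport G = loewyLength 2 G ∧ loewyLength 2 G = 2 ^ α + 2 ^ β + 1 := by
  have hα := Nat.two_pow_pos α
  have hβ : 2 ≤ 2 ^ β := by simpa using Nat.pow_le_pow_right (show 0 < 2 by norm_num) hβ1
  obtain ⟨hcomm, hdisj, rfl⟩ := hN
  obtain ⟨h1, h2⟩ := jacobson_of_conjugation (a := a) (b := b⁻¹) (c := c)
    (v := 2 ^ α + 2 ^ β + 1) (r := r) (s := 1) (t := t)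
    (closure_eq_top_of_mul_zpow hgen) hcomm.symm (by simpa using hba) hbc (by
      intro i k j h
      refine monomial_eq_zero (α := α) (β := β) (δ := 1) (by rw [← ha, pow_orderOf_eq_one])
        (by rw [pow_one, ← hc, pow_orderOf_eq_one]) hcomm.symm ?_ i k j (by rw [pow_one]; omega)
      rw [inv_pow, inv_eq_one, inv_eq_iff_eq_inv]
      exact hbK)
  have hca : c ∉ zpowers a := by
    intro h
    have h1 : c = 1 := disjoint_def.1 hdisj (mem_zpowers c) h
    rw [h1, orderOf_one] at hc
    norm_num at hc
  refine orderedDavenport_eq_loewyLength h1 h2 _ ?_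
    (not_hasProductOneSubsequence_interleaved (a := a) (b := b) (c := c) (zpowers c ⊔ zpowers a)
      (le_sup_right (a := zpowers c) (mem_zpowers a))
      (le_sup_left (b := zpowers a) (mem_zpowers c)) ha hα hβ hb ?_ (conj_notMem_zpowers ?_) ?_)
  · simp only [List.length_append, List.length_replicate]
    omega
  · rcases hbK with h | h
    · rw [h]; exact one_mem _
    · rw [h]; exact inv_mem (pow_mem (mem_zpowers a) _)
  · rw [hba, inv_mul_cancel_right, mul_mem_cancel_left (mem_zpowers a),
      mul_mem_cancel_left (pow_mem (mem_zpowers a) _)]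
    exact hca
  · rw [hbc, inv_mul_cancel_right, mul_mem_cancel_right (pow_mem (mem_zpowers a) _)]
    exact hca

/-! ### The four families -/

theorem IsSemidirectWith.exists_mul_zpow {G : Type*} [Group G] {N : Subgroup G} {b : G}
    (h : IsSemidirectWith N b) (g : G) : ∃ n ∈ N, ∃ k : ℤ, g = n * b ^ k := by
  obtain ⟨⟨⟨n, hn⟩, ⟨_, k, rfl⟩⟩, hg⟩ := h.isComplement.2 g
  exact ⟨n, hn, k, hg.symm⟩

theorem IsSemidirectWith.pow_notMem {G : Type*} [Group G] {N : Subgroup G} {b : G} {m : ℕ}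
    (h : IsSemidirectWith N b) (hb : orderOf b = m) (j : ℕ) (h0 : 0 < j) (hj : j < m) :
    b ^ j ∉ N := by
  intro hmem
  have := disjoint_def.1 h.isComplement.disjoint hmem (pow_mem (mem_zpowers b) j)
  exact pow_ne_one_of_lt_orderOf h0.ne' (by omega) this

theorem inv_mul_eq_of_groupCommutator_eq {G : Type*} [Group G] {x y z : G}
    (h : groupCommutator x y = z) : y⁻¹ * x = x * z * y⁻¹ := by
  rw [← h, groupCommutator]; group

theorem invariants_of_isG1 {G : Type*} [Group G] [Finite G] {α β : ℕ} (h : IsG1 α β 1 G) :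
    orderedDavenport G = loewyLength 2 G ∧ loewyLength 2 G = 2 ^ α + 2 ^ β + 1 := by
  obtain ⟨⟨-, hβ, -⟩, a, b, c, N, hN, hNb, ha, hb, hc, hab, -, hbc⟩ := h
  rw [pow_one] at hc
  have h1 : b * c = c * b := by
    rw [← mul_one (c * b), ← hbc, groupCommutator]
    group
  have h2 : b⁻¹ * c = c * b⁻¹ := (Commute.inv_left h1).eq
  exact invariants_of_rank_two_base (r := 0) (t := 0) hβ hN hNb.normal hNb.exists_mul_zpow ha hc
    (hNb.pow_notMem hb) (Or.inl (by rw [← hb, pow_orderOf_eq_one]))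
    (by simpa using inv_mul_eq_of_groupCommutator_eq hab) (by simpa using h2)

theorem invariants_of_isG2 {G : Type*} [Group G] [Finite G] {α β γ : ℕ} (h : IsG2 α β γ G) :
    orderedDavenport G = loewyLength 2 G ∧ loewyLength 2 G = 2 ^ α + 2 ^ β - 1 := by
  obtain ⟨⟨hα, -, hγ, -⟩, a, b, hab, ha, hb, -, hcomm⟩ := h
  refine invariants_of_metacyclic (r := 2 ^ (α - γ - 1)) ha (hab.pow_notMem hb)
    (Or.inl (by rw [← hb, pow_orderOf_eq_one])) hab.exists_mul_zpow ?_
  rw [inv_mul_eq_of_groupCommutator_eq hcomm, ← pow_succ' 2,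
    show α - γ - 1 + 1 = α - γ by omega]

theorem invariants_of_isG3 {G : Type*} [Group G] [Finite G] {α β γ : ℕ} (h : IsG3 α β γ 1 G) :
    orderedDavenport G = loewyLength 2 G ∧ loewyLength 2 G = 2 ^ α + 2 ^ β + 1 := by
  obtain ⟨⟨hβ, hγ, -, hα⟩, a, b, c, N, hN, hNb, ha, hb, hc, -, hab, hcb⟩ := h
  rw [pow_one] at hc
  have hexp : 2 ^ (α - γ) = 2 * 2 ^ (α - γ - 1) := by
    rw [← pow_succ']; congr 1; omega
  have hexp' : 2 ^ (2 * (α - γ)) = 4 * 2 ^ (2 * (α - γ - 1)) := by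
    rw [show (4 : ℕ) = 2 ^ 2 by norm_num, ← pow_add]; congr 1; omega
  -- The factor `2 ^ α - 1` in `t` acts as `-1` on exponents of `a`, turning the inverse in `[c, b]`
  -- into a natural power; the factor in `c` disappears because `α > γ`.
  refine invariants_of_rank_two_base (r := 2 ^ (α - γ - 1))
    (t := 2 ^ (2 * (α - γ - 1)) * (2 ^ α - 1)) (by omega) hN hNb.normal
    hNb.exists_mul_zpow ha hc (hNb.pow_notMem hb)
    (Or.inl (by rw [← hb, pow_orderOf_eq_one])) ?_ ?_
  · rw [inv_mul_eq_of_groupCommutator_eq hab, hexp]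
  · have hc2 : c ^ 2 ^ (α - γ) = 1 := by
      rw [hexp, pow_mul, ← hc, pow_orderOf_eq_one, one_pow]
    have ha2 : (a ^ 2 ^ (2 * (α - γ)))⁻¹ =
        a ^ (4 * (2 ^ (2 * (α - γ - 1)) * (2 ^ α - 1))) := by
      rw [← mul_assoc, ← hexp']
      apply inv_eq_of_mul_eq_one_right
      rw [← pow_add, add_comm, ← Nat.mul_succ, Nat.succ_eq_add_one,
        Nat.sub_add_cancel Nat.one_le_two_pow, mul_comm, pow_mul, ← ha, pow_orderOf_eq_one,
        one_pow]
    rw [inv_mul_eq_of_groupCommutator_eq hcb, hc2, inv_one, mul_one, ha2]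

theorem not_commute_of_orderOf_groupCommutator {G : Type*} [Group G] {a b : G} {m : ℕ}
    (h : orderOf (groupCommutator a b) = m) (hm : m ≠ 1) : ¬ Commute a b := by
  intro hcomm
  apply hm
  rw [← h, orderOf_eq_one_iff, groupCommutator, mul_assoc, hcomm.eq]
  group

theorem invariants_of_isG4_one {G : Type*} [Group G] [Finite G] (h : IsG4 1 G) :
    orderedDavenport G = loewyLength 2 G ∧ loewyLength 2 G = 5 := by
  obtain ⟨-, a, b, c, N, hN, -, hgen, ha, -, hcomm, hc, hab, -, hpow⟩ := h
  obtain rfl : c = 1 := by simpa using hc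
  have hNa : N = zpowers a := by simpa using hN.eq_sup
  rw [hNa] at hgen
  -- This is the quaternion group: `a` has order `4`, `b ^ 2 = a ^ 2`, and `b` inverts `a`.
  refine invariants_of_metacyclic (α := 2) (β := 1) (r := 1) ha ?_ (Or.inr ?_) hgen ?_
  · intro j h0 hj hmem
    obtain rfl : j = 1 := by omega
    obtain ⟨k, hk⟩ := mem_zpowers_iff.1 hmem
    rw [pow_one] at hk
    exact not_commute_of_orderOf_groupCommutator hcomm (by norm_num)
      (hk ▸ (Commute.refl a).zpow_right k)
  · rw [← hpow, eq_inv_iff_mul_eq_one, ← pow_add, ← pow_orderOf_eq_one a, ha]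
    rfl
  · rw [inv_mul_eq_of_groupCommutator_eq hab, mul_one]

theorem invariants_of_isG4_two {G : Type*} [Group G] [Finite G] (h : IsG4 2 G) :
    orderedDavenport G = loewyLength 2 G ∧ loewyLength 2 G = 13 := by
  obtain ⟨-, a, b, c, N, hN, hnormal, hgen, ha, -, hcomm, hc, hab, hcb, hpow⟩ := h
  have ha8 : a ^ 8 = 1 := by simpa [ha] using pow_orderOf_eq_one a
  have hc2 : c ^ 2 = 1 := by simpa [hc] using pow_orderOf_eq_one c
  have ha4 : (a ^ 4)⁻¹ = a ^ 4 := by rw [inv_eq_iff_mul_eq_one, ← pow_add, ha8]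
  have hba := inv_mul_eq_of_groupCommutator_eq hab
  have hbc := inv_mul_eq_of_groupCommutator_eq hcb
  rw [hc2, inv_one, mul_one, ha4] at hbc
  have haN : a ∈ N := hN.eq_sup ▸ le_sup_right (a := zpowers c) (mem_zpowers a)
  have hcent : ∀ x ∈ N, Commute a x := by
    intro x hx
    have hle : N ≤ centralizer {a} := by
      rw [hN.eq_sup]
      refine sup_le (zpowers_le.2 ?_) (zpowers_le.2 ?_) <;> rw [mem_centralizer_singleton_iff]
      exact hN.commute.eq
    exact (mem_centralizer_singleton_iff.1 (hle hx)).symm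
  have hb1 : b ∉ N := fun h =>
    not_commute_of_orderOf_groupCommutator hcomm (by norm_num) (hcent b h)
  -- If `b ^ 2` were in the abelian group `N` it would centralize `a`, but conjugating twice by
  -- `b⁻¹` sends `a` to `a ^ 13`, while `a` has order `8`.
  have hb2 : b ^ 2 ∉ N := by
    intro h
    have h1 := hcent _ h
    have hφa : MulAut.conj b⁻¹ a = a ^ 3 * c := by
      rw [MulAut.conj_apply, hba, mul_inv_cancel_right, ← mul_assoc, ← pow_succ']
    have hφc : MulAut.conj b⁻¹ c = c * a ^ 4 := by
      rw [MulAut.conj_apply, hbc, mul_inv_cancel_right]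
    have hφ : MulAut.conj b⁻¹ (MulAut.conj b⁻¹ a) = a := by
      have e : MulAut.conj b⁻¹ (MulAut.conj b⁻¹ a) = (b ^ 2)⁻¹ * (a * b ^ 2) := by
        simp only [MulAut.conj_apply, pow_two]; group
      rw [e, h1.eq, inv_mul_cancel_left]
    rw [hφa, map_mul, map_pow, hφa, hφc, (hN.commute.symm.pow_left 3).mul_pow, ← pow_mul,
      mul_assoc, ← mul_assoc _ c, ← pow_succ, show 3 + 1 = 2 * 2 by norm_num, pow_mul c, hc2,
      one_pow, one_mul, ← pow_add] at hφ
    have h12 : a ^ 12 = 1 := by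
      have : a ^ 12 * a = 1 * a := by rw [← pow_succ, one_mul]; exact hφ
      exact mul_right_cancel this
    have := orderOf_dvd_of_pow_eq_one h12
    rw [ha] at this
    norm_num at this
  refine invariants_of_rank_two_base (α := 3) (β := 2) (r := 1) (t := 1) (by norm_num) hN hnormal
    hgen ha hc ?_ (Or.inr ?_) hba hbc
  · intro j h0 hj hmem
    norm_num at hj
    interval_cases j
    · exact hb1 (by simpa using hmem)
    · exact hb2 hmem
    -- Since `b ^ 4 = a ^ 4` lies in `N`, so would `b`.
    · apply hb1
      have h4 : b ^ 3 * b ∈ N := by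
        rw [← pow_succ]; exact hpow ▸ pow_mem haN _
      exact (mul_mem_cancel_left hmem).1 h4
  · rw [← hpow]; exact ha4.symm

theorem theorem1p5 (G : Type*) [Group G] [Finite G] :
    (∀ α β : ℕ, IsG1 α β 1 G →
      orderedDavenport G = loewyLength 2 G ∧ loewyLength 2 G = 2 ^ α + 2 ^ β + 1) ∧
    (∀ α β γ : ℕ, IsG2 α β γ G →
      orderedDavenport G = loewyLength 2 G ∧ loewyLength 2 G = 2 ^ α + 2 ^ β - 1) ∧
    (∀ α β γ : ℕ, IsG3 α β γ 1 G →
      orderedDavenport G = loewyLength 2 G ∧ loewyLength 2 G = 2 ^ α + 2 ^ β + 1) ∧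
    (∀ γ : ℕ, (γ = 1 ∨ γ = 2) → IsG4 γ G →
      orderedDavenport G = loewyLength 2 G ∧ loewyLength 2 G = 2 ^ (γ + 2) - 3) := by
  refine ⟨fun α β h => invariants_of_isG1 h, fun α β γ h => invariants_of_isG2 h,
    fun α β γ h => invariants_of_isG3 h, ?_⟩
  rintro γ (rfl | rfl) h
  · exact invariants_of_isG4_one h
  · exact invariants_of_isG4_two h
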